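/- Let $\mathcal K$ be a finite set with $|\mathcal K|=L$, and identify probability distributions on $\mathcal K$ with vectors $p\in[0,1]^L$, $\|p\|_1=1$. For integers $s,k\ge 1$, a $\mathcal K$-decorated $(s,k)$-stochastic shape model is a function $W$ on $[0,1]^2$ of the following form: $[0,1]^2$ is cut into $s$ symmetric regions, each of which is a union of blocks of the grid of side length $1/k$, and on the $c$-th region $W$ is constant, equal to a probability vector $Q_c$ on $\mathcal K$. Let $\Theta_{s,k}$ be the set of the arrays $\boldsymbol\theta=(\boldsymbol\theta_{ij})_{i,j\in[n]}$ with $\boldsymbol\theta_{ij}=W(\xi_i,\xi_j)$, where $W$ is a $\mathcal K$-decorated $(s,k)$-stochastic shape model and $\xi_1,\dots,\xi_n\in[0,1]$. (If one prefers graphs without loops, one sets instead $\boldsymbol\theta_{ii}=\delta_{x_0}$ for all $i$, with a fixed $x_0\in\mathcal K$, in all elements of $\Theta_{s,k}$; the result holds with either convention.) Given $\boldsymbol\theta\in\Theta_{s,k}$, one observes a random symmetric matrix $\boldsymbol A\in\mathcal K^{n\times n}$ whose entries $\boldsymbol A_{ij}$, $i\le j$, are independent, $\boldsymbol A_{ij}$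 having distribution $\boldsymbol\theta_{ij}$. Let $\boldsymbol X_{ij}\in\{0,1\}^L$ be the indicator vector of the value of $\boldsymbol A_{ij}$, and let $$\widehat{\boldsymbol\theta}\in\operatorname*{argmin}_{\boldsymbol\theta'\in\Theta_{s,k}}\frac1{n^2}\sum_{i,j\in[n]}\|\boldsymbol X_{ij}-\boldsymbol\theta'_{ij}\|_2^2$$ be a least-squares estimator. Then for every $C'>0$ there is a constant $C>0$, depending only on $C'$, such that for all finite $\mathcal K$, all $s,k\ge1$, all $n>\max(0,k^2-s)$ and every $\boldsymbol\theta\in\Theta_{s,k}$, $$\frac1{n^2}\sum_{i,j\in[n]}\|\widehat{\boldsymbol\theta}_{ij}-\boldsymbol\theta_{ij}\|_2^2\le C\left(\frac{sL}{n^2}+\frac{\log(\max(k,s))}{n}\right)$$ with probability at least $1-\exp(-C'n\log s)$. Furthermore, there is a universal constant $C_1>0$ such that, for all such $\mathcal K,s,k,n$, $$\sup_{\boldsymbol\theta\in\Theta_{s,k}}\mathbb E\left[\frac1{n^2}\sum_{i,j\in[n]}\|\widehat{\boldsymbol\theta}_{ij}-\boldsymbol\theta_{ij}\|_2^2\right]\le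 C_1\left(\frac{sL}{n^2}+\frac{\log(\max(k,s))}{n}\right).$$ -/

import Mathlib

open MeasureTheory ProbabilityTheory

/-- The index of the block of length `1 / k` of the unit interval that contains `x`:
the blocks are `[a / k, (a + 1) / k)` for `a + 1 < k`, and the last one is `[(k - 1) / k, 1]`. -/
noncomputable def blockIndex (k : ℕ) [NeZero k] (x : unitInterval) : Fin k :=
  ⟨min ⌊(k : ℝ) * (x : ℝ)⌋₊ (k - 1), by
    have := Nat.pos_of_ne_zero (NeZero.ne k)
    omega⟩

/-- `W` is a `K`-decorated `(s,k)`-stochastic shape model. The unit square is cut into `s` symmetric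
regions, each of them a union of blocks of side length `1 / k`: the block with index `(a, b)` lies
in the region number `shape a b`. On the region number `c`, `W` is constant, equal to the
probability vector `Q c` on `K`. -/
def IsShapeModel {K : Type*} [Fintype K] (s k : ℕ) [NeZero k]
    (W : unitInterval → unitInterval → K → ℝ) : Prop :=
  ∃ shape : Fin k → Fin k → Fin s, (∀ a b, shape a b = shape b a) ∧
    ∃ Q : Fin s → K → ℝ, (∀ c, Q c ∈ stdSimplex ℝ K) ∧
      ∀ x y, W x y = Q (shape (blockIndex k x) (blockIndex k y))

/-- The array `θ` with `θ i j = W (ξ i) (ξ j)`. The argument `diag` selects the convention for the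
diagonal: `none` means that `θ i i = W (ξ i) (ξ i)`, and `some x₀` is the convention of graphs
without loops, where each diagonal entry is the point mass at the decoration `x₀`. -/
def probMatrix {K : Type*} [DecidableEq K] {n : ℕ} (diag : Option K)
    (W : unitInterval → unitInterval → K → ℝ) (ξ : Fin n → unitInterval) :
    Fin n → Fin n → K → ℝ :=
  fun i j => if i = j then (diag.elim (W (ξ i) (ξ j)) fun x₀ => Pi.single x₀ 1)
    else W (ξ i) (ξ j)

/-- The set `Θ_{s,k}` of the `n × n` parameter arrays of `(s,k)`-stochastic shape models. -/
def shapeParams {K : Type*} [Fintype K] [DecidableEq K] (n s k : ℕ) [NeZero k]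
    (diag : Option K) : Set (Fin n → Fin n → K → ℝ) :=
  {θ | ∃ W : unitInterval → unitInterval → K → ℝ, IsShapeModel s k W ∧
    ∃ ξ : Fin n → unitInterval, θ = probMatrix diag W ξ}

/-- The squared Frobenius distance of two `n × n × L` arrays. -/
def frobSq {K : Type*} [Fintype K] {n : ℕ} (η θ : Fin n → Fin n → K → ℝ) : ℝ :=
  ∑ i, ∑ j, ∑ l, (η i j l - θ i j l) ^ 2

/-- The mean squared error `n⁻² ∑ i j, ‖η i j - θ i j‖²`. -/
noncomputable def mse {K : Type*} [Fintype K] {n : ℕ} (η θ : Fin n → Fin n → K → ℝ) : ℝ :=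
  1 / (n : ℝ) ^ 2 * frobSq η θ

/-- The 0-1 encoding `X` of an adjacency matrix `A` with entries in `K`. -/
def oneHot {K : Type*} [DecidableEq K] {n : ℕ} (A : Fin n → Fin n → K) :
    Fin n → Fin n → K → ℝ :=
  fun i j l => if A i j = l then 1 else 0

/-- `est` is a least-squares estimator over `Θ`: it maps the adjacency matrix of a decorated graph
to a minimizer over `Θ` of the mean squared distance to its encoding. -/
def IsLeastSquaresEstimator {K : Type*} [Fintype K] [DecidableEq K] {n : ℕ}
    (Θ : Set (Fin n → Fin n → K → ℝ))
    (est : (Fin n → Fin n → K) → Fin n → Fin n → K → ℝ) : Prop :=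
  ∀ A : Fin n → Fin n → K, (∀ i j, A i j = A j i) →
    est A ∈ Θ ∧ ∀ θ ∈ Θ, mse (oneHot A) (est A) ≤ mse (oneHot A) θ

/-- The random adjacency matrix `A` of a `K`-decorated graph follows the model with parameter `θ`:
it is symmetric, its entries with `i ≤ j` are independent, and `A i j` has law `θ i j`. -/
structure IsDecoratedGraph {K Ω : Type*} [MeasurableSpace K] [MeasurableSpace Ω] {n : ℕ}
    (μ : Measure Ω) (A : Ω → Fin n → Fin n → K) (θ : Fin n → Fin n → K → ℝ) : Prop where
  measurable : ∀ i j, Measurable fun ω => A ω i j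
  symm : ∀ ω i j, A ω i j = A ω j i
  indep : iIndepFun (fun (p : {p : Fin n × Fin n // p.1 ≤ p.2}) ω => A ω p.1.1 p.1.2) μ
  law : ∀ i j l, μ.real {ω | A ω i j = l} = θ i j l

/-! By minimality of the estimator, its error is at most twice the norm of the projection of the
noise onto a subspace containing the error. Averaging `exp ⟪ε, g⟫` over a standard Gaussian vector
`g` of such a subspace turns the sub-Gaussian bound on the linear functionals of the noise `ε` into
a bound on the exponential moment of its squared projection, as for a chi-square variable with as
many degrees of freedom as the dimension. It remains to sum over the possible subspaces. A parameter
is determined by the blocks of the `n` vertices (`k ^ n` choices), the partition of the `k ^ 2`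
blocks into classes, and one vector per class. Since `k ^ 2 - s < n`, some collapse of the blocks
obtained by `n` successive merges (at most `k ^ (4 n)` choices) has at most `s` classes and is
compatible with the partition, so `k ^ (5 n)` subspaces of dimension at most `(s + 1) L` suffice.
The exponential moment of the error is thus at most `exp (5 (s L + n log (max k s)))`, and the two
bounds follow by Chernoff's and Jensen's inequalities. -/

open scoped NNReal

section StdGaussian

theorem gaussianPDFReal_mul_exp_mul_sq (t x : ℝ) :
    gaussianPDFReal 0 1 x * Real.exp (t * x ^ 2)
      = (√(2 * Real.pi))⁻¹ * Real.exp (-(1 / 2 - t) * x ^ 2) := by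
  simp only [gaussianPDFReal, NNReal.coe_one, mul_one, sub_zero, mul_assoc, ← Real.exp_add]
  ring_nf

theorem integrable_exp_mul_sq_gaussianReal {t : ℝ} (ht : 2 * t < 1) :
    Integrable (fun x => Real.exp (t * x ^ 2)) (gaussianReal 0 1) := by
  rw [gaussianReal_of_var_ne_zero _ one_ne_zero,
    integrable_withDensity_iff_integrable_smul' (measurable_gaussianPDF _ _)
      (ae_of_all _ fun _ => gaussianPDF_lt_top)]
  simp only [toReal_gaussianPDF, smul_eq_mul, gaussianPDFReal_mul_exp_mul_sq]
  exact (integrable_exp_neg_mul_sq (by linarith)).const_mul _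

theorem integral_exp_mul_sq_gaussianReal {t : ℝ} (ht : 2 * t < 1) :
    ∫ x, Real.exp (t * x ^ 2) ∂gaussianReal 0 1 = (√(1 - 2 * t))⁻¹ := by
  have : 0 < 1 - 2 * t := by linarith
  simp only [integral_gaussianReal_eq_integral_smul one_ne_zero, smul_eq_mul,
    gaussianPDFReal_mul_exp_mul_sq, integral_const_mul, integral_gaussian]
  rw [← Real.sqrt_inv, ← Real.sqrt_inv, ← Real.sqrt_mul (by positivity)]
  congr 1
  field_simp

variable {E : Type*} [NormedAddCommGroup E] [InnerProductSpace ℝ E] [FiniteDimensional ℝ E]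
  [MeasurableSpace E] [BorelSpace E]

theorem lintegral_exp_inner_stdGaussian (v : E) :
    ∫⁻ g, ENNReal.ofReal (Real.exp (inner ℝ v g)) ∂stdGaussian E
      = ENNReal.ofReal (Real.exp (‖v‖ ^ 2 / 2)) := by
  have hlaw : (stdGaussian E).map (innerSL ℝ v) = gaussianReal 0 (‖v‖₊ ^ 2) := by
    rw [IsGaussian.map_eq_gaussianReal, integral_strongDual_stdGaussian,
      variance_dual_stdGaussian, innerSL_apply_norm]
    congr
    simp [Real.toNNReal_pow, norm_toNNReal]
  have hmgf := mgf_gaussianReal hlaw 1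
  have hint : Integrable (fun g : E => Real.exp (inner ℝ v g)) (stdGaussian E) := by
    have := integrable_exp_mul_gaussianReal (μ := 0) (v := ‖v‖₊ ^ 2) 1
    rw [← hlaw, integrable_map_measure (by fun_prop) (by fun_prop)] at this
    simpa [Function.comp_def] using this
  rw [← ofReal_integral_eq_lintegral_ofReal hint (ae_of_all _ fun g => Real.exp_nonneg _)]
  simpa [mgf] using congrArg ENNReal.ofReal hmgf

theorem lintegral_exp_mul_norm_sq_stdGaussian {t : ℝ} (ht : 2 * t < 1) :
    ∫⁻ g, ENNReal.ofReal (Real.exp (t * ‖g‖ ^ 2)) ∂stdGaussian E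
      = ENNReal.ofReal ((√(1 - 2 * t))⁻¹ ^ Module.finrank ℝ E) := by
  let b := stdOrthonormalBasis ℝ E
  have hnorm (x : Fin (Module.finrank ℝ E) → ℝ) :
      Real.exp (t * ‖∑ r, x r • b r‖ ^ 2) = ∏ r, Real.exp (t * x r ^ 2) := by
    rw [← Real.exp_sum, ← Finset.mul_sum, ← b.sum_sq_norm_inner_right]
    simp [b.orthonormal.inner_right_fintype]
  rw [stdGaussian_eq_map_pi_orthonormalBasis b, lintegral_map (by fun_prop) (by fun_prop)]
  simp only [hnorm]
  rw [← ofReal_integral_eq_lintegral_ofReal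
    (Integrable.fintype_prod fun _ => integrable_exp_mul_sq_gaussianReal ht)
    (ae_of_all _ fun x => Finset.prod_nonneg fun r _ => Real.exp_nonneg _),
    integral_fintype_prod_eq_pow (ι := Fin (Module.finrank ℝ E)) fun x : ℝ => Real.exp (t * x ^ 2),
    integral_exp_mul_sq_gaussianReal ht, Fintype.card_fin]

end StdGaussian

section SubgaussianVector

variable {Ω H : Type*} {mΩ : MeasurableSpace Ω} {μ : Measure Ω}
  [NormedAddCommGroup H] [InnerProductSpace ℝ H] {ε : Ω → H} {c : ℝ≥0}

/-- A random vector `ε` is sub-Gaussian with variance proxy `c` if each of its marginals `⟪v, ε⟫` is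
sub-Gaussian with variance proxy `c ‖v‖ ^ 2`. This is the assumption on the noise under which the
error of least squares is controlled here; no independence of coordinates is involved. -/
structure IsSubgaussianVector (ε : Ω → H) (c : ℝ≥0) (μ : Measure Ω) : Prop where
  aestronglyMeasurable : AEStronglyMeasurable ε μ
  hasSubgaussianMGF : ∀ v, HasSubgaussianMGF (fun ω => inner ℝ v (ε ω)) (c * ‖v‖₊ ^ 2) μ

namespace IsSubgaussianVector

theorem lintegral_exp_inner_le (hε : IsSubgaussianVector ε c μ) (v : H) :
    ∫⁻ ω, ENNReal.ofReal (Real.exp (inner ℝ v (ε ω))) ∂μ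
      ≤ ENNReal.ofReal (Real.exp (c * ‖v‖ ^ 2 / 2)) := by
  have hint := (hε.hasSubgaussianMGF v).integrable_exp_mul 1
  have hmgf := (hε.hasSubgaussianMGF v).mgf_le 1
  simp only [mgf, one_mul, one_pow, mul_one, NNReal.coe_mul, NNReal.coe_pow, coe_nnnorm]
    at hint hmgf
  rw [← ofReal_integral_eq_lintegral_ofReal hint (ae_of_all _ fun _ => Real.exp_nonneg _)]
  exact ENNReal.ofReal_le_ofReal hmgf

theorem lintegral_exp_norm_sq_starProjection_le [SFinite μ] (hε : IsSubgaussianVector ε c μ)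
    (W : Submodule ℝ H) [FiniteDimensional ℝ W] {t : ℝ} (ht : 0 ≤ t) (htc : 2 * (c * t) < 1) :
    ∫⁻ ω, ENNReal.ofReal (Real.exp (t * ‖W.starProjection (ε ω)‖ ^ 2)) ∂μ
      ≤ ENNReal.ofReal ((√(1 - 2 * (c * t)))⁻¹ ^ Module.finrank ℝ W) := by
  borelize ↥W
  have hadj (ω : Ω) (g : W) : inner ℝ (√(2 * t) • W.orthogonalProjectionOnto (ε ω)) g
      = inner ℝ (√(2 * t) • (g : H)) (ε ω) := by
    rw [real_inner_smul_left, real_inner_smul_left,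
      Submodule.inner_orthogonalProjectionOnto_eq_of_mem_right, real_inner_comm]
  have hP : AEStronglyMeasurable (fun ω => √(2 * t) • W.orthogonalProjectionOnto (ε ω)) μ :=
    (W.orthogonalProjectionOnto.continuous.comp_aestronglyMeasurable
      hε.aestronglyMeasurable).const_smul (√(2 * t))
  have hjoint : AEMeasurable (fun p : Ω × W => ENNReal.ofReal (Real.exp
      (inner ℝ (√(2 * t) • W.orthogonalProjectionOnto (ε p.1)) p.2))) (μ.prod (stdGaussian W)) :=
    (hP.comp_fst.inner aestronglyMeasurable_id.comp_snd).aemeasurable.exp.ennreal_ofReal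
  -- Decoupling: `exp (t ‖Pε‖ ^ 2)` is the average of `exp ⟪√(2t) Pε, g⟫` over a standard Gaussian
  -- `g`, so that after Fubini the hypothesis on `ε` applies for each fixed `g`.
  calc ∫⁻ ω, ENNReal.ofReal (Real.exp (t * ‖W.starProjection (ε ω)‖ ^ 2)) ∂μ
      = ∫⁻ ω, ∫⁻ g, ENNReal.ofReal (Real.exp
          (inner ℝ (√(2 * t) • W.orthogonalProjectionOnto (ε ω)) g)) ∂stdGaussian W ∂μ := by
        refine lintegral_congr fun ω => ?_
        rw [lintegral_exp_inner_stdGaussian, norm_smul, mul_pow, Real.norm_eq_abs, sq_abs,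
          Real.sq_sqrt (by positivity), W.starProjection_apply, Submodule.norm_coe]
        ring_nf
    _ = ∫⁻ g, ∫⁻ ω, ENNReal.ofReal (Real.exp (inner ℝ (√(2 * t) • (g : H)) (ε ω))) ∂μ
          ∂stdGaussian W := by
        rw [lintegral_lintegral_swap hjoint]
        simp only [hadj]
    _ ≤ ∫⁻ g, ENNReal.ofReal (Real.exp (c * t * ‖g‖ ^ 2)) ∂stdGaussian W := by
        refine lintegral_mono fun g => (hε.lintegral_exp_inner_le _).trans_eq ?_
        rw [norm_smul, mul_pow, Real.norm_eq_abs, sq_abs, Real.sq_sqrt (by positivity),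
          Submodule.norm_coe]
        ring_nf
    _ = _ := lintegral_exp_mul_norm_sq_stdGaussian htc

end IsSubgaussianVector

theorem norm_le_two_mul_norm_starProjection (W : Submodule ℝ H) [W.HasOrthogonalProjection]
    {u e : H} (hu : u ∈ W) (h : ‖e - u‖ ≤ ‖e‖) : ‖u‖ ≤ 2 * ‖W.starProjection e‖ := by
  have hinner : inner ℝ e u = inner ℝ (W.starProjection e) u := by
    rw [Submodule.inner_starProjection_left_eq_right, Submodule.starProjection_eq_self_iff.2 hu]
  have hsq : ‖u‖ * ‖u‖ ≤ 2 * ‖W.starProjection e‖ * ‖u‖ := by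
    have := norm_sub_sq_real e u
    have := pow_le_pow_left₀ (norm_nonneg _) h 2
    have := real_inner_le_norm (W.starProjection e) u
    linarith
  rcases (norm_nonneg u).eq_or_lt with h0 | hpos
  · rw [← h0]
    positivity
  · exact le_of_mul_le_mul_right hsq hpos

theorem one_le_inv_sqrt_one_sub {x : ℝ} (hx : 0 ≤ x) (hx1 : x < 1) : 1 ≤ (√(1 - x))⁻¹ :=
  (one_le_inv₀ (Real.sqrt_pos.2 (by linarith))).2 (Real.sqrt_le_one.2 (by linarith))

theorem IsSubgaussianVector.lintegral_exp_norm_sq_le_of_mem_iUnion [SFinite μ] {ι : Type*}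
    [Fintype ι] (hε : IsSubgaussianVector ε c μ) (V : ι → Submodule ℝ H)
    [∀ i, FiniteDimensional ℝ (V i)] {d : ℕ} (hd : ∀ i, Module.finrank ℝ (V i) ≤ d) {u : Ω → H}
    (hu : ∀ ω, ∃ i, u ω ∈ V i) (hmin : ∀ ω, ‖ε ω - u ω‖ ≤ ‖ε ω‖) {t : ℝ} (ht : 0 ≤ t)
    (htc : 2 * (c * t) < 1) :
    ∫⁻ ω, ENNReal.ofReal (Real.exp (t * (‖u ω‖ / 2) ^ 2)) ∂μ
      ≤ Fintype.card ι * ENNReal.ofReal ((√(1 - 2 * (c * t)))⁻¹ ^ d) := by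
  let F (i : ι) (ω : Ω) := ENNReal.ofReal (Real.exp (t * ‖(V i).starProjection (ε ω)‖ ^ 2))
  have hF (i : ι) : AEMeasurable (F i) μ :=
    ((((V i).starProjection.continuous.comp_aestronglyMeasurable
      hε.aestronglyMeasurable).norm.aemeasurable.pow_const 2).const_mul t).exp.ennreal_ofReal
  calc ∫⁻ ω, ENNReal.ofReal (Real.exp (t * (‖u ω‖ / 2) ^ 2)) ∂μ
      ≤ ∫⁻ ω, ∑ i, F i ω ∂μ := by
        refine lintegral_mono fun ω => ?_
        obtain ⟨i, hi⟩ := hu ω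
        have hproj := norm_le_two_mul_norm_starProjection (V i) hi (hmin ω)
        refine le_trans ?_
          (Finset.single_le_sum (f := (F · ω)) (fun _ _ => zero_le) (Finset.mem_univ i))
        dsimp only [F]
        gcongr
        linarith
    _ = ∑ i, ∫⁻ ω, F i ω ∂μ := lintegral_finsetSum' _ fun i _ => hF i
    _ ≤ ∑ _ : ι, ENNReal.ofReal ((√(1 - 2 * (c * t)))⁻¹ ^ d) := by
        gcongr with i
        refine (hε.lintegral_exp_norm_sq_starProjection_le (V i) ht htc).trans ?_
        gcongr
        · exact one_le_inv_sqrt_one_sub (by positivity) htc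
        · exact hd i
    _ = _ := by rw [Finset.sum_const, Finset.card_univ, nsmul_eq_mul]

theorem IsSubgaussianVector.lintegral_exp_norm_sub_sq_le_of_leastSquares [SFinite μ] {ι : Type*}
    [Fintype ι] {X θhat : Ω → H} {θ : H} (hX : IsSubgaussianVector (fun ω => X ω - θ) c μ)
    (V : ι → Submodule ℝ H) [∀ i, FiniteDimensional ℝ (V i)] {d : ℕ}
    (hd : ∀ i, Module.finrank ℝ (V i) ≤ d) (hmem : ∀ ω, ∃ i, θhat ω ∈ V i)
    (hmin : ∀ ω, ‖X ω - θhat ω‖ ≤ ‖X ω - θ‖) {t : ℝ} (ht : 0 ≤ t) (htc : 2 * (c * t) < 1) :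
    ∫⁻ ω, ENNReal.ofReal (Real.exp (t * (‖θhat ω - θ‖ / 2) ^ 2)) ∂μ
      ≤ Fintype.card ι * ENNReal.ofReal ((√(1 - 2 * (c * t)))⁻¹ ^ (d + 1)) := by
  -- The subspaces are enlarged by `θ`, so that they contain `θhat ω - θ`.
  refine hX.lintegral_exp_norm_sq_le_of_mem_iUnion (fun i => V i ⊔ Submodule.span ℝ {θ})
    (fun i => ?_) (fun ω => ?_) (fun ω => by simpa using hmin ω) ht htc
  · exact (Submodule.finrank_add_le_finrank_add_finrank _ _).trans
      (add_le_add (hd i) (by simpa using finrank_span_le_card (R := ℝ) {θ}))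
  · obtain ⟨i, hi⟩ := hmem ω
    exact ⟨i, sub_mem (Submodule.mem_sup_left hi)
      (Submodule.mem_sup_right (Submodule.mem_span_singleton_self θ))⟩

end SubgaussianVector

section Mgf

variable {Ω : Type*} {mΩ : MeasurableSpace Ω} {μ : Measure Ω} [IsProbabilityMeasure μ]
  {X : Ω → ℝ} {t b : ℝ}

theorem one_sub_exp_le_measureReal_of_mgf_le_exp (ht : 0 ≤ t)
    (hexp : Integrable (fun ω => Real.exp (t * X ω)) μ) (hb : mgf X μ t ≤ Real.exp b) (a : ℝ) :
    1 - Real.exp (b - t * a) ≤ μ.real {ω | X ω ≤ a} := by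
  have htail : μ.real {ω | X ω ≤ a}ᶜ ≤ Real.exp (b - t * a) :=
    calc μ.real {ω | X ω ≤ a}ᶜ ≤ μ.real {ω | a ≤ X ω} :=
          measureReal_mono fun ω (hω : ¬X ω ≤ a) => (not_le.1 hω).le
      _ ≤ Real.exp (-t * a) * mgf X μ t := measure_ge_le_exp_mul_mgf a ht hexp
      _ ≤ Real.exp (-t * a) * Real.exp b := by gcongr
      _ = Real.exp (b - t * a) := by rw [← Real.exp_add]; ring_nf
  have hunion := measureReal_union_le (μ := μ) {ω | X ω ≤ a} {ω | X ω ≤ a}ᶜ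
  rw [Set.union_compl_self, probReal_univ] at hunion
  linarith

theorem mul_integral_le_of_mgf_le_exp (hint : Integrable X μ)
    (hexp : Integrable (fun ω => Real.exp (t * X ω)) μ) (hb : mgf X μ t ≤ Real.exp b) :
    t * ∫ ω, X ω ∂μ ≤ b := by
  have hjensen := convexOn_exp.map_integral_le Real.continuous_exp.continuousOn isClosed_univ
    (ae_of_all _ fun _ => Set.mem_univ _) (hint.const_mul t) hexp
  rw [integral_const_mul] at hjensen
  exact Real.exp_le_exp.1 (hjensen.trans hb)

end Mgf

section Collapse

variable {T α : Type*} [Fintype T] [Nonempty T] [Fintype α]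

theorem exists_finset_comp_eq_self_ncard_range_le (m : ℕ) :
    ∃ P : Finset (T → T), P.card ≤ Fintype.card T ^ (2 * m) ∧ ∀ f : T → α, ∃ π ∈ P,
      f ∘ π = f ∧ (Set.range π).ncard ≤ max (Fintype.card α) (Fintype.card T - m) := by
  classical
  induction m with
  | zero => exact ⟨{id}, by simp, fun f => ⟨id, by simp⟩⟩
  | succ m ih =>
    -- While the range of `π` has more than `card α` points, `f` identifies two of them, and sending
    -- one to the other keeps `f ∘ π = f`. There are `card T ^ 2` such merges.
    obtain ⟨P, hcard, hP⟩ := ih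
    let merge (p : T × T) (π : T → T) : T → T := Function.update id p.1 p.2 ∘ π
    refine ⟨Finset.image₂ merge Finset.univ P, ?_, fun f => ?_⟩
    · calc _ ≤ Fintype.card (T × T) * P.card := Finset.card_image₂_le _ _ _
        _ ≤ Fintype.card T ^ 2 * Fintype.card T ^ (2 * m) := by
          rw [Fintype.card_prod, ← sq]
          gcongr
        _ = _ := by ring
    obtain ⟨π, hπ, hfπ, hrange⟩ := hP f
    rcases le_or_gt (Set.range π).ncard (Fintype.card α) with hsmall | hlarge
    · obtain ⟨a⟩ := ‹Nonempty T›
      refine ⟨π, ?_, hfπ, hsmall.trans (le_max_left _ _)⟩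
      exact Finset.mem_image₂.2 ⟨(a, a), Finset.mem_univ _, π, hπ, by
        rw [show merge (a, a) π = Function.update id a (id a) ∘ π from rfl,
          Function.update_eq_self, Function.id_comp]⟩
    · obtain ⟨x, hx, y, hy, hxy, hfxy⟩ := Set.exists_ne_map_eq_of_ncard_lt_of_maps_to
        (s := Set.range π) (t := Set.univ) (by simpa [Set.ncard_univ] using hlarge)
        (f := f) (fun _ _ => Set.mem_univ _)
      refine ⟨merge (x, y) π, Finset.mem_image₂_of_mem (Finset.mem_univ _) hπ, ?_, ?_⟩
      · have : f ∘ Function.update id x y = f := by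
          rw [Function.comp_update, Function.comp_id, ← hfxy, Function.update_eq_self]
        rw [← Function.comp_assoc, this, hfπ]
      · have hsub : Set.range (merge (x, y) π) ⊆ Set.range π \ {x} := by
          rintro _ ⟨z, rfl⟩
          by_cases hz : π z = x
          · simpa [merge, hz, hxy.symm] using hy
          · simp [merge, hz]
        have := Set.ncard_le_ncard hsub
        have := Set.ncard_sdiff_singleton_of_mem hx
        omega

end Collapse

theorem sum_sum_eq_sum_subtype_le {ι M : Type*} [LinearOrder ι] [Fintype ι] [AddCommMonoid M]
    (f : ι → ι → M) :
    ∑ i, ∑ j, f i j = ∑ p : {p : ι × ι // p.1 ≤ p.2},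
      (f p.1.1 p.1.2 + if p.1.1 = p.1.2 then 0 else f p.1.2 p.1.1) := by
  have hlower : ∑ p : ι × ι with ¬p.1 ≤ p.2, f p.1 p.2
      = ∑ p : ι × ι with p.1 ≤ p.2, if p.1 = p.2 then 0 else f p.2 p.1 := by
    rw [Finset.sum_ite, Finset.sum_const_zero, zero_add, Finset.filter_filter]
    refine Finset.sum_nbij' Prod.swap Prod.swap ?_ ?_ ?_ ?_ ?_ <;> grind
  rw [← Fintype.sum_prod_type', ← Finset.sum_filter_add_sum_filter_not _ fun p => p.1 ≤ p.2,
    hlower, ← Finset.sum_add_distrib]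
  exact Finset.sum_subtype _ (by simp) _

section Indicator

variable {Ω : Type*} {mΩ : MeasurableSpace Ω} {μ : Measure Ω}

theorem hasSubgaussianMGF_mono {X : Ω → ℝ} {c d : ℝ≥0} (h : HasSubgaussianMGF X c μ)
    (hcd : c ≤ d) : HasSubgaussianMGF X d μ where
  integrable_exp_mul := h.integrable_exp_mul
  mgf_le t := (h.mgf_le t).trans (by gcongr)

variable {K : Type*} [Fintype K] [MeasurableSpace K] [DiscreteMeasurableSpace K]
  [IsProbabilityMeasure μ] {a : Ω → K}

theorem integral_comp_eq_sum_measureReal_mul (ha : Measurable a) (w : K → ℝ) :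
    ∫ ω, w (a ω) ∂μ = ∑ l, μ.real {ω | a ω = l} * w l := by
  rw [← integral_map ha.aemeasurable (measurable_of_countable w).aestronglyMeasurable,
    integral_fintype (Integrable.of_finite)]
  simp only [map_measureReal_apply ha (measurableSet_singleton _), smul_eq_mul]
  rfl

theorem hasSubgaussianMGF_sum_indicator_sub [DecidableEq K] (ha : Measurable a) (w : K → ℝ) :
    HasSubgaussianMGF (fun ω => ∑ l, ((if a ω = l then 1 else 0) - μ.real {ω | a ω = l}) * w l)
      (∑ l, ‖w l‖₊ ^ 2) μ := by
  have hcenter : (fun ω => ∑ l, ((if a ω = l then 1 else 0) - μ.real {ω | a ω = l}) * w l)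
      = fun ω => w (a ω) - ∫ ω, w (a ω) ∂μ := by
    funext ω
    simp [integral_comp_eq_sum_measureReal_mul ha, sub_mul, Finset.sum_sub_distrib]
  have hbound : ∀ᵐ ω ∂μ, w (a ω) ∈ Set.Icc (-‖w‖) ‖w‖ :=
    ae_of_all _ fun ω => abs_le.1 (norm_le_pi_norm w (a ω))
  have hsup : ‖w‖₊ ^ 2 ≤ ∑ l, ‖w l‖₊ ^ 2 :=
    NNReal.le_sqrt_iff_sq_le.1 <| (pi_nnnorm_le_iff (r := NNReal.sqrt (∑ l, ‖w l‖₊ ^ 2))).2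
      fun l => NNReal.le_sqrt_iff_sq_le.2 <|
        Finset.single_le_sum (f := fun l => ‖w l‖₊ ^ 2) (fun _ _ => zero_le) (Finset.mem_univ l)
  rw [hcenter]
  refine hasSubgaussianMGF_mono (hasSubgaussianMGF_of_mem_Icc
    ((measurable_of_countable w).comp ha).aemeasurable hbound) (le_trans (le_of_eq ?_) hsup)
  rw [sub_neg_eq_add, ← two_mul, nnnorm_mul, nnnorm_norm, Real.nnnorm_two,
    mul_div_cancel_left₀ _ two_ne_zero]

end Indicator

section Arrays

variable {K : Type*} [Fintype K] {n : ℕ}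

/-- An array with entries in `K → ℝ` as a vector of a Euclidean space, whose norm then gives the
Frobenius distance. -/
noncomputable def arrayVec (η : Fin n → Fin n → K → ℝ) : EuclideanSpace ℝ (Fin n × Fin n × K) :=
  WithLp.toLp 2 fun p => η p.1 p.2.1 p.2.2

theorem norm_sq_arrayVec_sub (η θ : Fin n → Fin n → K → ℝ) :
    ‖arrayVec η - arrayVec θ‖ ^ 2 = frobSq η θ := by
  simp [EuclideanSpace.norm_sq_eq, arrayVec, frobSq, Fintype.sum_prod_type]

theorem inner_arrayVec_sub (v : EuclideanSpace ℝ (Fin n × Fin n × K))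
    (η θ : Fin n → Fin n → K → ℝ) :
    inner ℝ v (arrayVec η - arrayVec θ)
      = ∑ i, ∑ j, ∑ l, (η i j l - θ i j l) * v (i, j, l) := by
  simp [PiLp.inner_apply, arrayVec, Fintype.sum_prod_type]

theorem mse_le_mul_iff (hn : 0 < n) (η θ : Fin n → Fin n → K → ℝ) (C a b : ℝ) :
    mse η θ ≤ C * (a / (n : ℝ) ^ 2 + b / n) ↔ frobSq η θ ≤ C * (a + n * b) := by
  have : C * (a / (n : ℝ) ^ 2 + b / n) = 1 / (n : ℝ) ^ 2 * (C * (a + n * b)) := by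
    field_simp
  rw [this, mse, mul_le_mul_iff_right₀ (by positivity)]

end Arrays

namespace IsDecoratedGraph

variable {K Ω : Type*} [MeasurableSpace K] [MeasurableSpace Ω] {μ : Measure Ω} {n : ℕ}
  {A : Ω → Fin n → Fin n → K} {θ : Fin n → Fin n → K → ℝ}

theorem measurable_array (hA : IsDecoratedGraph μ A θ) : Measurable A :=
  measurable_pi_lambda _ fun i => measurable_pi_lambda _ fun j => hA.measurable i j

theorem param_symm (hA : IsDecoratedGraph μ A θ) (i j : Fin n) : θ i j = θ j i := by
  funext l
  simp only [← hA.law, hA.symm _ i j]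

theorem integrable_comp [Finite K] [DiscreteMeasurableSpace K] [IsFiniteMeasure μ]
    (hA : IsDecoratedGraph μ A θ) (f : (Fin n → Fin n → K) → ℝ) :
    Integrable (fun ω => f (A ω)) μ :=
  (Integrable.of_finite (μ := μ.map A) (f := f)).comp_measurable hA.measurable_array

variable [Fintype K] [DecidableEq K] [DiscreteMeasurableSpace K] [IsProbabilityMeasure μ]

theorem hasSubgaussianMGF_sum_noise (hA : IsDecoratedGraph μ A θ) (v : Fin n → Fin n → K → ℝ) :
    HasSubgaussianMGF (fun ω => ∑ i, ∑ j, ∑ l, (oneHot (A ω) i j l - θ i j l) * v i j l)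
      (2 * ∑ i, ∑ j, ∑ l, ‖v i j l‖₊ ^ 2) μ := by
  let w (p : {p : Fin n × Fin n // p.1 ≤ p.2}) (l : K) : ℝ :=
    v p.1.1 p.1.2 l + if p.1.1 = p.1.2 then 0 else v p.1.2 p.1.1 l
  let noise (p : {p : Fin n × Fin n // p.1 ≤ p.2}) (a : K) : ℝ :=
    ∑ l, ((if a = l then 1 else 0) - μ.real {ω | A ω p.1.1 p.1.2 = l}) * w p l
  have hsum : (fun ω => ∑ i, ∑ j, ∑ l, (oneHot (A ω) i j l - θ i j l) * v i j l)
      = fun ω => ∑ p, noise p (A ω p.1.1 p.1.2) := by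
    funext ω
    rw [sum_sum_eq_sum_subtype_le]
    refine Finset.sum_congr rfl fun p _ => ?_
    have hswap : oneHot (A ω) p.1.2 p.1.1 = oneHot (A ω) p.1.1 p.1.2 := by
      funext l
      simp only [oneHot, hA.symm ω p.1.2 p.1.1]
    simp only [noise, w, mul_add, Finset.sum_add_distrib, hA.law, hswap,
      hA.param_symm p.1.2 p.1.1]
    split_ifs <;> simp [oneHot]
  have hnorm : ∑ p, ∑ l, ‖w p l‖₊ ^ 2 ≤ 2 * ∑ i, ∑ j, ∑ l, ‖v i j l‖₊ ^ 2 := by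
    rw [sum_sum_eq_sum_subtype_le, Finset.mul_sum]
    refine Finset.sum_le_sum fun p _ => ?_
    calc ∑ l, ‖w p l‖₊ ^ 2
        ≤ ∑ l, 2 * (‖v p.1.1 p.1.2 l‖₊ ^ 2
          + if p.1.1 = p.1.2 then 0 else ‖v p.1.2 p.1.1 l‖₊ ^ 2) := by
          gcongr with l
          rw [← NNReal.coe_le_coe]
          dsimp only [w]
          split_ifs
          · simpa [two_mul] using sq_nonneg (v p.1.1 p.1.2 l)
          · simpa using add_sq_le (a := v p.1.1 p.1.2 l) (b := v p.1.2 p.1.1 l)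
      _ = _ := by
        rw [← Finset.mul_sum, Finset.sum_add_distrib]
        split_ifs <;> simp
  rw [hsum]
  exact hasSubgaussianMGF_mono (HasSubgaussianMGF.sum_of_iIndepFun
    (hA.indep.comp noise fun _ => measurable_of_countable _)
    fun p _ => hasSubgaussianMGF_sum_indicator_sub (hA.measurable p.1.1 p.1.2) (w p)) hnorm

theorem isSubgaussianVector (hA : IsDecoratedGraph μ A θ) :
    IsSubgaussianVector (fun ω => arrayVec (oneHot (A ω)) - arrayVec θ) 2 μ where
  aestronglyMeasurable := ((measurable_of_countable fun a : Fin n → Fin n → K =>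
    arrayVec (oneHot a) - arrayVec θ).comp hA.measurable_array).aestronglyMeasurable
  hasSubgaussianMGF v := by
    have hv : ‖v‖₊ ^ 2 = ∑ i, ∑ j, ∑ l, ‖v (i, j, l)‖₊ ^ 2 := by
      ext
      simp [EuclideanSpace.norm_sq_eq, Fintype.sum_prod_type]
    simp only [inner_arrayVec_sub, hv]
    exact hA.hasSubgaussianMGF_sum_noise fun i j l => v (i, j, l)

end IsDecoratedGraph

section FiberConstant

variable {ι κ : Type*}

/-- The space of vectors indexed by `ι` that are constant on the fibers of `φ`. The parameters whose
entries have prescribed classes, but arbitrary values on each class, form such a space. -/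
def fiberConstant (φ : ι → κ) : Submodule ℝ (EuclideanSpace ℝ ι) :=
  LinearMap.range ((WithLp.linearEquiv 2 ℝ (ι → ℝ)).symm.toLinearMap ∘ₗ LinearMap.funLeft ℝ ℝ φ)

theorem mem_fiberConstant_of_forall_eq {φ : ι → κ} {v : EuclideanSpace ℝ ι} {Q : κ → ℝ}
    (h : ∀ i, v i = Q (φ i)) : v ∈ fiberConstant φ :=
  ⟨Q, PiLp.ext fun i => (h i).symm⟩

theorem finrank_fiberConstant_le [Fintype κ] (φ : ι → κ) :
    Module.finrank ℝ (fiberConstant φ) ≤ Fintype.card κ :=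
  (LinearMap.finrank_range_le _).trans_eq (Module.finrank_fintype_fun_eq_card ℝ)

end FiberConstant

section Cover

variable {K : Type*} [Fintype K] [DecidableEq K] {n s k : ℕ} {diag : Option K}

/-- The class of the entry `(i, j)` of an array whose rows have the block indices `z`: the block
`(z i, z j)`, except that under the convention of graphs without loops (`diag ≠ none`) the diagonal
entries form a class `none` of their own. An array in `shapeParams n s k diag` depends on `(i, j)`
only through this class. -/
def pairClass (diag : Option K) (z : Fin n → Fin k) (i j : Fin n) : Option (Fin k × Fin k) :=
  if i = j ∧ diag.isSome then none else some (z i, z j)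

theorem exists_eq_map_pairClass_of_mem_shapeParams [NeZero k] {θ : Fin n → Fin n → K → ℝ}
    (hθ : θ ∈ shapeParams n s k diag) :
    ∃ (z : Fin n → Fin k) (f : Fin k × Fin k → Fin s) (Q : Option (Fin s) → K → ℝ),
      ∀ i j, θ i j = Q ((pairClass diag z i j).map f) := by
  obtain ⟨W, ⟨shape, -, Q, -, hW⟩, ξ, rfl⟩ := hθ
  refine ⟨fun i => blockIndex k (ξ i), Function.uncurry shape,
    fun c => c.elim (diag.elim 0 fun x₀ => Pi.single x₀ 1) Q, fun i j => ?_⟩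
  by_cases hij : i = j <;> cases diag <;> simp [probMatrix, pairClass, hW, hij]

theorem pos_of_mem_shapeParams [NeZero k] {θ : Fin n → Fin n → K → ℝ}
    (hθ : θ ∈ shapeParams n s k diag) : 0 < s * Fintype.card K := by
  obtain ⟨W, ⟨shape, -, Q, hQ, -⟩, -⟩ := hθ
  have hK : Nonempty K := by
    by_contra! hempty
    simpa using (hQ (shape 0 0)).2
  exact Nat.mul_pos (shape 0 0).pos Fintype.card_pos

theorem exists_finset_submodule_cover_shapeParams [NeZero k] (hk : k ^ 2 ≤ s + n) :
    ∃ 𝒲 : Finset (Submodule ℝ (EuclideanSpace ℝ (Fin n × Fin n × K))),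
      𝒲.card ≤ k ^ (5 * n) ∧
      (∀ W ∈ 𝒲, Module.finrank ℝ W ≤ (s + 1) * Fintype.card K) ∧
      ∀ θ ∈ shapeParams n s k diag, ∃ W ∈ 𝒲, arrayVec θ ∈ W := by
  classical
  obtain ⟨P, hcard, hP⟩ :=
    exists_finset_comp_eq_self_ncard_range_le (T := Fin k × Fin k) (α := Fin s) n
  let W (z : Fin n → Fin k) (π : Fin k × Fin k → Fin k × Fin k) :
      Submodule ℝ (EuclideanSpace ℝ (Fin n × Fin n × K)) :=
    fiberConstant fun p => ((pairClass diag z p.1 p.2.1).map (Set.rangeFactorization π), p.2.2)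
  refine ⟨Finset.image₂ W Finset.univ {π ∈ P | (Set.range π).ncard ≤ s}, ?_, ?_, ?_⟩
  · calc _ ≤ Fintype.card (Fin n → Fin k) * P.card := (Finset.card_image₂_le _ _ _).trans
          (Nat.mul_le_mul_left _ (Finset.card_filter_le _ _))
      _ ≤ k ^ n * (k ^ 2) ^ (2 * n) := by
        simp only [Fintype.card_fun, Fintype.card_prod, Fintype.card_fin, ← sq] at hcard ⊢
        gcongr
      _ = k ^ (5 * n) := by ring
  · simp only [Finset.forall_mem_image₂, Finset.mem_filter]
    rintro z - π ⟨-, hrange⟩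
    refine (finrank_fiberConstant_le _).trans ?_
    rw [Fintype.card_prod, Fintype.card_option, ← Nat.card_eq_fintype_card, Nat.card_coe_set_eq]
    gcongr
  · intro θ hθ
    obtain ⟨z, f, Q, hQ⟩ := exists_eq_map_pairClass_of_mem_shapeParams hθ
    obtain ⟨π, hπ, hf, hrange⟩ := hP f
    have hrange : (Set.range π).ncard ≤ s := by
      simp only [Fintype.card_prod, Fintype.card_fin] at hrange
      grind
    refine ⟨W z π, Finset.mem_image₂_of_mem (Finset.mem_univ z) (by simp [hπ, hrange]), ?_⟩
    refine mem_fiberConstant_of_forall_eq (Q := fun c => Q (c.1.map (f ∘ (↑))) c.2) fun p => ?_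
    have hfac : (f ∘ (↑)) ∘ Set.rangeFactorization π = f := hf
    simp only [arrayVec, hQ, Option.map_map, hfac]

end Cover

theorem pow_mul_sqrt_two_pow_le_exp {n s k L : ℕ} (hk : 0 < k) (hsL : 0 < s * L) :
    (k : ℝ) ^ (5 * n) * √2 ^ ((s + 1) * L + 1)
      ≤ Real.exp (5 * (s * L + n * Real.log (max k s))) := by
  have hsqrt : √2 ≤ Real.exp (1 / 2) := by
    rw [Real.sqrt_le_iff, ← Real.exp_nat_mul]
    exact ⟨Real.exp_nonneg _, by norm_num; linarith [Real.add_one_le_exp 1]⟩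
  have hdim : (((s + 1) * L + 1 : ℕ) : ℝ) * (1 / 2) ≤ 5 * (s * L) := by
    have hL : L ≤ s * L := Nat.le_mul_of_pos_left L (pos_of_mul_pos_left hsL (Nat.zero_le L))
    have : (s + 1) * L + 1 ≤ 3 * (s * L) := by linarith
    have : (((s + 1) * L + 1 : ℕ) : ℝ) ≤ 3 * (s * L) := by exact_mod_cast this
    have : (0 : ℝ) ≤ s * L := by positivity
    linarith
  have hlog : Real.log k ≤ Real.log (max k s) :=
    Real.log_le_log (by exact_mod_cast hk) (le_max_left _ _)
  calc (k : ℝ) ^ (5 * n) * √2 ^ ((s + 1) * L + 1)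
      ≤ Real.exp (Real.log k) ^ (5 * n) * Real.exp (1 / 2) ^ ((s + 1) * L + 1) := by
        rw [Real.exp_log (by exact_mod_cast hk)]
        gcongr
    _ = Real.exp ((5 * n : ℕ) * Real.log k + ((s + 1) * L + 1 : ℕ) * (1 / 2)) := by
        rw [Real.exp_add, Real.exp_nat_mul, Real.exp_nat_mul]
    _ ≤ Real.exp (5 * (s * L + n * Real.log (max k s))) := by
        gcongr
        push_cast at hdim ⊢
        nlinarith [mul_le_mul_of_nonneg_left hlog (Nat.cast_nonneg (α := ℝ) n)]

section LeastSquares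

variable {K : Type*} [Fintype K] [DecidableEq K] {n s k : ℕ}
  {est : (Fin n → Fin n → K) → Fin n → Fin n → K → ℝ} {θ : Fin n → Fin n → K → ℝ}

theorem IsLeastSquaresEstimator.norm_arrayVec_sub_le {Θ : Set (Fin n → Fin n → K → ℝ)}
    (hest : IsLeastSquaresEstimator Θ est) (hn : 0 < n) (hθ : θ ∈ Θ)
    {a : Fin n → Fin n → K} (ha : ∀ i j, a i j = a j i) :
    ‖arrayVec (oneHot a) - arrayVec (est a)‖ ≤ ‖arrayVec (oneHot a) - arrayVec θ‖ := by
  refine le_of_sq_le_sq ?_ (norm_nonneg _)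
  rw [norm_sq_arrayVec_sub, norm_sq_arrayVec_sub]
  exact le_of_mul_le_mul_left ((hest a ha).2 θ hθ) (by positivity)

variable [MeasurableSpace K] [DiscreteMeasurableSpace K] {Ω : Type*} [MeasurableSpace Ω]
  {μ : Measure Ω} [IsProbabilityMeasure μ] [NeZero k] {diag : Option K}
  {A : Ω → Fin n → Fin n → K}

theorem IsDecoratedGraph.mgf_frobSq_le (hA : IsDecoratedGraph μ A θ)
    (hest : IsLeastSquaresEstimator (shapeParams n s k diag) est)
    (hθ : θ ∈ shapeParams n s k diag) (hn : 0 < n) (hk : k ^ 2 ≤ s + n) :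
    mgf (fun ω => frobSq (est (A ω)) θ) μ (1 / 32)
      ≤ Real.exp (5 * (s * Fintype.card K + n * Real.log (max k s))) := by
  obtain ⟨𝒲, hcard, hdim, hcover⟩ :=
    exists_finset_submodule_cover_shapeParams (K := K) (diag := diag) hk
  have hexp (ω : Ω) : Real.exp (1 / 32 * frobSq (est (A ω)) θ)
      = Real.exp (1 / 8 * (‖arrayVec (est (A ω)) - arrayVec θ‖ / 2) ^ 2) := by
    rw [← norm_sq_arrayVec_sub]
    ring_nf
  have hbase : (√(1 - 2 * (((2 : ℝ≥0) : ℝ) * (1 / 8))))⁻¹ = √2 := by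
    rw [← Real.sqrt_inv]
    norm_num
  rw [← ENNReal.ofReal_le_ofReal_iff (Real.exp_nonneg _)]
  simp only [mgf]
  rw [ofReal_integral_eq_lintegral_ofReal
    (hA.integrable_comp fun a => Real.exp (1 / 32 * frobSq (est a) θ))
    (ae_of_all _ fun _ => Real.exp_nonneg _)]
  simp only [hexp]
  calc _ ≤ Fintype.card 𝒲 * ENNReal.ofReal (√2 ^ ((s + 1) * Fintype.card K + 1)) := by
        rw [← hbase]
        exact hA.isSubgaussianVector.lintegral_exp_norm_sub_sq_le_of_leastSquares
          (fun W : 𝒲 => W.1) (fun W => hdim W W.2)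
          (fun ω => by simpa using hcover _ (hest _ (hA.symm ω)).1)
          (fun ω => hest.norm_arrayVec_sub_le hn hθ (hA.symm ω)) (by norm_num) (by norm_num)
    _ ≤ ENNReal.ofReal (k ^ (5 * n) * √2 ^ ((s + 1) * Fintype.card K + 1)) := by
        rw [← ENNReal.ofReal_natCast, ← ENNReal.ofReal_mul (Nat.cast_nonneg _),
          Fintype.card_coe]
        gcongr
        exact_mod_cast hcard
    _ ≤ _ := ENNReal.ofReal_le_ofReal
        (pow_mul_sqrt_two_pow_le_exp (NeZero.pos k) (pos_of_mem_shapeParams hθ))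

theorem IsDecoratedGraph.one_sub_exp_le_measureReal_mse_le (hA : IsDecoratedGraph μ A θ)
    (hest : IsLeastSquaresEstimator (shapeParams n s k diag) est)
    (hθ : θ ∈ shapeParams n s k diag) (hn : 0 < n) (hk : k ^ 2 ≤ s + n) (x : ℝ) :
    1 - Real.exp (-(x * (s * Fintype.card K + n * Real.log (max k s)))) ≤
      μ.real {ω | mse (est (A ω)) θ ≤ 32 * (5 + x) *
        ((s : ℝ) * Fintype.card K / (n : ℝ) ^ 2 + Real.log (max (k : ℝ) (s : ℝ)) / n)} := by
  simp only [mse_le_mul_iff hn]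
  convert one_sub_exp_le_measureReal_of_mgf_le_exp (by norm_num)
    (hA.integrable_comp fun a => Real.exp (1 / 32 * frobSq (est a) θ))
    (hA.mgf_frobSq_le hest hθ hn hk) _ using 3
  ring

theorem IsDecoratedGraph.integral_mse_le (hA : IsDecoratedGraph μ A θ)
    (hest : IsLeastSquaresEstimator (shapeParams n s k diag) est)
    (hθ : θ ∈ shapeParams n s k diag) (hn : 0 < n) (hk : k ^ 2 ≤ s + n) :
    ∫ ω, mse (est (A ω)) θ ∂μ ≤ 160 *
      ((s : ℝ) * Fintype.card K / (n : ℝ) ^ 2 + Real.log (max (k : ℝ) (s : ℝ)) / n) := by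
  have hfrob := mul_integral_le_of_mgf_le_exp (hA.integrable_comp fun a => frobSq (est a) θ)
    (hA.integrable_comp fun a => Real.exp (1 / 32 * frobSq (est a) θ))
    (hA.mgf_frobSq_le hest hθ hn hk)
  simp only [mse, integral_const_mul]
  calc 1 / (n : ℝ) ^ 2 * ∫ ω, frobSq (est (A ω)) θ ∂μ
      ≤ 1 / (n : ℝ) ^ 2 * (160 * (s * Fintype.card K + n * Real.log (max k s))) := by
        gcongr
        linarith
    _ = _ := by field_simp

end LeastSquares

theorem theorem1 :
    (∀ C' : ℝ, 0 < C' → ∃ C : ℝ, 0 < C ∧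
      ∀ (K : Type*) [Fintype K] [DecidableEq K] [MeasurableSpace K] [DiscreteMeasurableSpace K]
        (n s k : ℕ) [NeZero k] (_ : 0 < s) (_ : max 0 ((k : ℤ) ^ 2 - (s : ℤ)) < (n : ℤ))
        (diag : Option K) (est : (Fin n → Fin n → K) → Fin n → Fin n → K → ℝ),
        IsLeastSquaresEstimator (shapeParams n s k diag) est →
        ∀ θ ∈ shapeParams n s k diag,
        ∀ (Ω : Type*) [MeasurableSpace Ω] (μ : Measure Ω) [IsProbabilityMeasure μ]
          (A : Ω → Fin n → Fin n → K), IsDecoratedGraph μ A θ →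
          1 - Real.exp (-(C' * n * Real.log s)) ≤
            μ.real {ω | mse (est (A ω)) θ ≤
              C * ((s : ℝ) * Fintype.card K / (n : ℝ) ^ 2
                + Real.log (max (k : ℝ) (s : ℝ)) / n)}) ∧
    (∃ C₁ : ℝ, 0 < C₁ ∧
      ∀ (K : Type*) [Fintype K] [DecidableEq K] [MeasurableSpace K] [DiscreteMeasurableSpace K]
        (n s k : ℕ) [NeZero k] (_ : 0 < s) (_ : max 0 ((k : ℤ) ^ 2 - (s : ℤ)) < (n : ℤ))
        (diag : Option K) (est : (Fin n → Fin n → K) → Fin n → Fin n → K → ℝ),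
        IsLeastSquaresEstimator (shapeParams n s k diag) est →
        ∀ θ ∈ shapeParams n s k diag,
        ∀ (Ω : Type*) [MeasurableSpace Ω] (μ : Measure Ω) [IsProbabilityMeasure μ]
          (A : Ω → Fin n → Fin n → K), IsDecoratedGraph μ A θ →
          ∫ ω, mse (est (A ω)) θ ∂μ ≤
            C₁ * ((s : ℝ) * Fintype.card K / (n : ℝ) ^ 2
              + Real.log (max (k : ℝ) (s : ℝ)) / n)) := by
  refine ⟨fun C' hC' => ⟨32 * (5 + C'), by positivity, ?_⟩, 160, by norm_num, ?_⟩
  · intro K _ _ _ _ n s k _ hs hn diag est hest θ hθ Ω _ μ _ A hA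
    refine le_trans ?_ (hA.one_sub_exp_le_measureReal_mse_le hest hθ (by lia) (by lia) C')
    have hlog : Real.log s ≤ Real.log (max k s) :=
      Real.log_le_log (by exact_mod_cast hs) (le_max_right _ _)
    have : (0 : ℝ) ≤ s * Fintype.card K := by positivity
    gcongr 1 - Real.exp (-?_)
    calc C' * n * Real.log s = C' * (n * Real.log s) := mul_assoc _ _ _
      _ ≤ C' * (s * Fintype.card K + n * Real.log (max k s)) := by
        gcongr
        exact le_add_of_nonneg_of_le this (by gcongr)
  · intro K _ _ _ _ n s k _ _ hn diag est hest θ hθ Ω _ μ _ A hA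
    exact hA.integral_mse_le hest hθ (by lia) (by lia)
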